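/- Let $\mathbb K$ be $\mathbb R$ or $\mathbb C$, let $m\ge k\ge 1$ be integers, let $\mathbf p=(p_1,\dots,p_m)\in[1,\infty]^m$ be such that $\left|\frac1{\mathbf p}\right|:=\frac1{p_1}+\cdots+\frac1{p_m}\le\frac12$ (with $\frac1\infty=0$), and let $n_1,\dots,n_k\ge1$ be integers with $n_1+\cdots+n_k=m$. Write $(e_{i_1}^{n_1},\dots,e_{i_k}^{n_k})$ for the $m$-tuple of canonical vectors $(e_{i_1},\dots,e_{i_1},\dots,e_{i_k},\dots,e_{i_k})$ in which $e_{i_j}$ is repeated $n_j$ times. Call $\rho\in(0,\infty)$ admissible if there is a constant $C$ such that $$\Big(\sum_{i_1,\dots,i_k=1}^{N}\big|T(e_{i_1}^{n_1},\dots,e_{i_k}^{n_k})\big|^{\rho}\Big)^{1/\rho}\le C\,\|T\|$$ for all positive integers $N$ and all $m$-linear forms $T:\ell_{p_1}^N\times\cdots\times\ell_{p_m}^N\to\mathbb K$, and let the optimal exponent $\rho_{\mathrm{opt}}$ be the infimum of all admissible $\rho$. Then the exponent $\frac{2k}{k+1-2|1/\mathbf p|}$ is admissible, and $$s\le\rho_{\mathrm{opt}}\le\frac{2k}{k+1-2\left|1/\mathbf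 p\right|},\qquad s:=\begin{cases}\left(1-\left|1/\mathbf p\right|\right)^{-1}&\text{if }k\le\dfrac{m+1-2|1/\mathbf p|}{2-2|1/\mathbf p|},\\[3mm]\dfrac{2k}{m+1-2\left|1/\mathbf p\right|}&\text{if }k\ge\dfrac{m+1-2|1/\mathbf p|}{2-2|1/\mathbf p|}.\end{cases}$$ (The two formulas agree when both conditions hold.) -/

import Mathlib

open scoped ENNReal

noncomputable section

namespace PartialHardyLittlewood

/-- `|1/p| = 1/p₁ + ⋯ + 1/pₘ`, with `1/∞ = 0`. -/
def recipSum {m : ℕ} (p : Fin m → ℝ≥0∞) : ℝ :=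
  ∑ l, ((p l)⁻¹).toReal

/-- For `n₁ + ⋯ + nₖ = m`, cut `{0, …, m - 1}` into consecutive blocks of lengths `n₁, …, nₖ`:
the index of the block in which the position `l` lies. -/
def block {k m : ℕ} (n : Fin k → ℕ) (hn : ∑ j, n j = m) (l : Fin m) : Fin k :=
  (finSigmaFinEquiv.symm (Fin.cast hn.symm l)).1

/-- The `m`-tuple `(e_{i₁}, …, e_{i₁}, …, e_{iₖ}, …, e_{iₖ})` of canonical vectors, where `e_{iⱼ}`
is repeated `nⱼ` times; its `l`-th entry is a vector of `ℓ_{p_l}^N`. -/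
def repeatedBasis (𝕜 : Type*) [RCLike 𝕜] {k m : ℕ} (p : Fin m → ℝ≥0∞) (n : Fin k → ℕ)
    (hn : ∑ j, n j = m) {N : ℕ} (i : Fin k → Fin N) (l : Fin m) :
    PiLp (p l) (fun _ : Fin N => 𝕜) :=
  WithLp.toLp (p l) (Pi.single (i (block n hn l)) (1 : 𝕜))

/-- The Hardy–Littlewood inequality with partial sums holds with exponent `ρ` and constant `C`,
for all `N ≥ 1` and all `m`-linear forms `T : ℓ_{p₁}^N × ⋯ × ℓ_{pₘ}^N → 𝕜`. -/
def Inequality (𝕜 : Type*) [RCLike 𝕜] {k m : ℕ} (p : Fin m → ℝ≥0∞) [∀ l, Fact (1 ≤ p l)]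
    (n : Fin k → ℕ) (hn : ∑ j, n j = m) (ρ C : ℝ) : Prop :=
  ∀ N : ℕ, 1 ≤ N →
    ∀ T : ContinuousMultilinearMap 𝕜 (fun l : Fin m => PiLp (p l) (fun _ : Fin N => 𝕜)) 𝕜,
      (∑ i : Fin k → Fin N, ‖T (repeatedBasis 𝕜 p n hn i)‖ ^ ρ) ^ (1 / ρ) ≤ C * ‖T‖

/-- The exponents `ρ > 0` for which the inequality holds with some constant that depends neither
on `N` nor on `T`. -/
def admissibleExponents (𝕜 : Type*) [RCLike 𝕜] {k m : ℕ} (p : Fin m → ℝ≥0∞)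
    [∀ l, Fact (1 ≤ p l)] (n : Fin k → ℕ) (hn : ∑ j, n j = m) : Set ℝ :=
  {ρ | 0 < ρ ∧ ∃ C : ℝ, Inequality 𝕜 p n hn ρ C}

/-- The optimal exponent: the infimum of the admissible exponents. -/
def optimalExponent (𝕜 : Type*) [RCLike 𝕜] {k m : ℕ} (p : Fin m → ℝ≥0∞)
    [∀ l, Fact (1 ≤ p l)] (n : Fin k → ℕ) (hn : ∑ j, n j = m) : ℝ :=
  sInf (admissibleExponents 𝕜 p n hn)

end PartialHardyLittlewood

end

/-! Write σ = |1/p| and let a_i be the modulus of T at the repeated basis vectors.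

Upper bound. Give each block j a probability vector u_j and feed T vectors whose entries are
u_j^{1/p_l} times numbers of modulus at most 1; these lie in the unit balls. Averaging over signs
removes the indices that are not constant on blocks (`norm_sum_repeated_le`), so the k-linear form
with coefficients of modulus a_i W_i, where W is the product of the weights, is bounded by ‖T‖ on
ℓ_∞-balls. Khinchine's inequality turns this into mixed (1, 2)-norm estimates for aW, for every u
and every distinguished coordinate (`sum_sqrt_fiber_le`). In place of interpolation,
`rpow_sum_rpow_le_of_mixed` makes one choice of u adapted to a and compares entropies; the exponent
2k/(k+1-2σ) is the one for which they balance.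

Lower bound. The diagonal form has norm at most N^{1-σ} and N coefficients equal to 1 among those
summed, so 1/ρ ≤ 1-σ (`exists_diagonal_form`). Some form with all coefficients ±1 has norm at most a
constant times (1 + log N) N^{(m+1)/2-σ}, while N^k coefficients are summed, so k/ρ ≤ (m+1)/2-σ
(`exists_sign_form`). The number s is the larger of the two resulting bounds. -/

namespace PartialHardyLittlewood

open Finset

/-! ### Weighted means -/

/-- Hölder's inequality for a product of powers of sub-probability vectors. -/
theorem sum_prod_rpow_le_card_rpow {ι κ : Type*} [Fintype ι] [Nonempty ι] [Fintype κ]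
    (u : κ → ι → ℝ) (hu : ∀ l t, 0 ≤ u l t) (hu1 : ∀ l, ∑ t, u l t ≤ 1) (r : κ → ℝ)
    (hr : ∀ l, 0 ≤ r l) (hr1 : ∑ l, r l ≤ 1) :
    ∑ t, ∏ l, u l t ^ r l ≤ (Fintype.card ι : ℝ) ^ (1 - ∑ l, r l) := by
  have hN : (0 : ℝ) < Fintype.card ι := by exact_mod_cast Fintype.card_pos
  have key (t : ι) : ((Fintype.card ι : ℝ)⁻¹) ^ (1 - ∑ l, r l) * ∏ l, u l t ^ r l ≤
      (1 - ∑ l, r l) * (Fintype.card ι : ℝ)⁻¹ + ∑ l, r l * u l t := by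
    -- The missing weight 1 - ∑ r goes to the uniform vector 1/N, with N the cardinality of `ι`; its
    -- power is what appears on the right-hand side.
    have := Real.geom_mean_le_arith_mean_weighted (univ : Finset (Option κ))
      (fun o => o.elim (1 - ∑ l, r l) r)
      (fun o => o.elim (Fintype.card ι : ℝ)⁻¹ (fun l => u l t)) ?_ ?_ ?_
    · simpa [Fintype.prod_option, Fintype.sum_option] using this
    · rintro (_ | l) -
      · simpa using hr1
      · exact hr l
    · simp [Fintype.sum_option]
    · rintro (_ | l) -
      · simp
      · exact hu l t
  have hsum := sum_le_sum fun t (_ : t ∈ univ) => key t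
  rw [← mul_sum, sum_add_distrib, sum_comm] at hsum
  have h2 : ∑ l, ∑ t, r l * u l t ≤ ∑ l, r l :=
    sum_le_sum fun l _ => by
      rw [← mul_sum]
      exact mul_le_of_le_one_right (hr l) (hu1 l)
  have h3 : ∑ _t : ι, (1 - ∑ l, r l) * (Fintype.card ι : ℝ)⁻¹ = 1 - ∑ l, r l := by
    simp only [sum_const, card_univ, nsmul_eq_mul]
    field_simp
  rw [h3, Real.inv_rpow hN.le] at hsum
  have h4 : ((Fintype.card ι : ℝ) ^ (1 - ∑ l, r l))⁻¹ * ∑ t, ∏ l, u l t ^ r l ≤ 1 := by linarith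
  rwa [inv_mul_le_iff₀ (Real.rpow_pos_of_pos hN _), mul_one] at h4

/-! ### The unit balls of `ℓ_p` -/

/-- Take u = |x|^p. Describing the balls by weights treats p = ∞ on the same footing, as exponent 0.
-/
theorem PiLp.exists_weight {𝕜 ι : Type*} [NormedAddCommGroup 𝕜] [Fintype ι] (p : ℝ≥0∞)
    [Fact (1 ≤ p)] (x : PiLp p (fun _ : ι => 𝕜)) (hx : ‖x‖ ≤ 1) :
    ∃ u : ι → ℝ, (∀ t, 0 ≤ u t) ∧ ∑ t, u t ≤ 1 ∧ ∀ t, ‖x t‖ ≤ u t ^ (p⁻¹).toReal := by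
  by_cases hp : p = ∞
  · subst hp
    -- Here the exponent is 0 and `0 ^ 0 = 1`, so the zero weight works.
    refine ⟨fun _ => 0, by simp, by simp, fun t => ?_⟩
    simpa using (PiLp.norm_apply_le x t).trans hx
  · have h1 : 1 ≤ p := Fact.out
    have hp0 : 0 < p.toReal := ENNReal.toReal_pos (by positivity) hp
    refine ⟨fun t => ‖x t‖ ^ p.toReal, fun t => by positivity, ?_, fun t => ?_⟩
    · rw [PiLp.norm_eq_sum hp0] at hx
      have h0 : 0 ≤ ∑ t, ‖x t‖ ^ p.toReal := by positivity
      by_contra! hcon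
      exact (Real.one_lt_rpow hcon (by positivity : 0 < 1 / p.toReal)).not_ge hx
    · rw [ENNReal.toReal_inv, Real.rpow_rpow_inv (norm_nonneg _) hp0.ne']

theorem PiLp.norm_le_one_of_weight {𝕜 ι : Type*} [NormedAddCommGroup 𝕜] [Fintype ι] (p : ℝ≥0∞)
    [Fact (1 ≤ p)] (x : PiLp p (fun _ : ι => 𝕜)) (u : ι → ℝ) (hu : ∀ t, 0 ≤ u t)
    (hu1 : ∑ t, u t ≤ 1) (hx : ∀ t, ‖x t‖ ≤ u t ^ (p⁻¹).toReal) : ‖x‖ ≤ 1 := by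
  by_cases hp : p = ∞
  · subst hp
    rw [PiLp.norm_eq_ciSup]
    exact Real.iSup_le (fun t => by simpa using hx t) zero_le_one
  · have h1 : 1 ≤ p := Fact.out
    have hp0 : 0 < p.toReal := ENNReal.toReal_pos (by positivity) hp
    rw [PiLp.norm_eq_sum hp0]
    refine Real.rpow_le_one (by positivity) (le_trans (sum_le_sum fun t _ => ?_) hu1)
      (by positivity)
    calc ‖x t‖ ^ p.toReal ≤ (u t ^ (p⁻¹).toReal) ^ p.toReal :=
          Real.rpow_le_rpow (norm_nonneg _) (hx t) hp0.le
      _ = u t := by rw [ENNReal.toReal_inv, Real.rpow_inv_rpow (hu t) hp0.ne']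

/-! ### The entropy argument -/

/-- Gibbs' inequality. -/
theorem sum_mul_log_le {ι : Type*} [Fintype ι] (π ν : ι → ℝ) (hπ : ∀ i, 0 ≤ π i)
    (hπ1 : ∑ i, π i = 1) (hν : ∀ i, 0 ≤ ν i) (hν1 : ∑ i, ν i ≤ 1)
    (hac : ∀ i, 0 < π i → 0 < ν i) :
    ∑ i, π i * Real.log (ν i) ≤ ∑ i, π i * Real.log (π i) := by
  have key (i : ι) : π i * Real.log (ν i) ≤ π i * Real.log (π i) + (ν i - π i) := by
    rcases (hπ i).eq_or_lt with h | h
    · rw [← h]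
      simpa using hν i
    -- `hac` is essential: with `log 0 = 0`, a zero of ν in the support of π would contribute 0
    -- instead of -∞.
    · have h1 := Real.log_le_sub_one_of_pos (div_pos (hac i h) h)
      rw [Real.log_div (hac i h).ne' h.ne'] at h1
      have h2 := mul_le_mul_of_nonneg_left h1 h.le
      have h3 : π i * (ν i / π i - 1) = ν i - π i := by field_simp
      linarith
  have := sum_le_sum fun i (_ : i ∈ univ) => key i
  rw [sum_add_distrib, sum_sub_distrib] at this
  linarith

/-- Mixed `(1, 2)`-norm estimates for all weights `∏ u ^ r` give an `ℓ_ρ` estimate: test the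
hypothesis at the marginals of the probability vector proportional to `a ^ ρ`, for the coordinate
whose marginal has the largest entropy. -/
theorem rpow_sum_rpow_le_of_mixed {J ι L : Type*} [Fintype J] [Nonempty J] [DecidableEq J]
    [Fintype ι] [DecidableEq ι] [Fintype L] (bl : L → J) (r : L → ℝ) (hr : ∀ l, 0 ≤ r l)
    (hr1 : ∑ l, r l ≤ 1 / 2) (a : (J → ι) → ℝ) (ha : ∀ i, 0 ≤ a i) (M ρ : ℝ) (hM : 0 ≤ M)
    (hρ : 0 < ρ) (hρ' : 1 / ρ = (Fintype.card J + 1 - 2 * ∑ l, r l) / (2 * Fintype.card J))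
    (H : ∀ u : J → ι → ℝ, (∀ j t, 0 ≤ u j t) → (∀ j, ∑ t, u j t = 1) → ∀ j,
      ∑ t, √(∑ i with i j = t, (a i * ∏ l, u (bl l) (i (bl l)) ^ r l) ^ 2) ≤ M) :
    (∑ i, a i ^ ρ) ^ (1 / ρ) ≤ M := by
  set Z := ∑ i, a i ^ ρ with hZ
  have hZ0 : 0 ≤ Z := sum_nonneg fun i _ => Real.rpow_nonneg (ha i) _
  rcases hZ0.eq_or_lt with hZ' | hZpos
  · rw [← hZ', Real.zero_rpow (by positivity)]
    exact hM
  set π : (J → ι) → ℝ := fun i => a i ^ ρ / Z with hπdef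
  have hπ0 (i) : 0 ≤ π i := div_nonneg (Real.rpow_nonneg (ha i) _) hZ0
  have hπ1 : ∑ i, π i = 1 := by
    rw [hπdef, ← sum_div, ← hZ, div_self hZpos.ne']
  set u : J → ι → ℝ := fun j t => ∑ i with i j = t, π i with hu
  have hu0 (j t) : 0 ≤ u j t := sum_nonneg fun i _ => hπ0 i
  have hu1 (j) : ∑ t, u j t = 1 := by
    rw [← hπ1]
    exact sum_fiberwise univ (fun i : J → ι => i j) π
  have hpos (i) (hi : 0 < π i) (j) : 0 < u j (i j) :=
    hi.trans_le (single_le_sum (f := π) (fun i _ => hπ0 i) (by simp))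
  have hmarg (j : J) (f : ι → ℝ) : ∑ t, u j t * f t = ∑ i, π i * f (i j) := by
    rw [← sum_fiberwise univ (fun i : J → ι => i j)]
    refine sum_congr rfl fun t _ => ?_
    rw [hu, sum_mul]
    refine sum_congr rfl fun i hi => ?_
    rw [(mem_filter.1 hi).2]
  have hapos (i) (hi : 0 < π i) : 0 < a i := by
    rcases (ha i).eq_or_lt with h | h
    · simp [hπdef, ← h, Real.zero_rpow hρ.ne'] at hi
    · exact h
  -- Entropies of the marginals; j maximizes them.
  set h : J → ℝ := fun j => -∑ i, π i * Real.log (u j (i j)) with hh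
  obtain ⟨j, -, hj⟩ := exists_max_image univ h univ_nonempty
  replace hj : ∀ s, h s ≤ h j := fun s => hj s (mem_univ s)
  set W : (J → ι) → ℝ := fun i => ∏ l, u (bl l) (i (bl l)) ^ r l with hW
  have hWpos (i) (hi : 0 < π i) : 0 < W i :=
    prod_pos fun l _ => Real.rpow_pos_of_pos (hpos i hi _) _
  set Q : ι → ℝ := fun t => ∑ i with i j = t, (a i * W i) ^ 2 with hQ
  set D := ∑ t, √(Q t) with hD
  have hDM : D ≤ M := H u hu0 hu1 j
  refine le_trans ?_ hDM
  have hQ0 (t) : 0 ≤ Q t := sum_nonneg fun i _ => sq_nonneg _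
  have hQpos (i) (hi : 0 < π i) : 0 < Q (i j) :=
    (pow_pos (mul_pos (hapos i hi) (hWpos i hi)) 2).trans_le
      (single_le_sum (f := fun i => (a i * W i) ^ 2) (fun i _ => sq_nonneg _) (by simp))
  obtain ⟨i₀, hi₀⟩ : ∃ i, 0 < π i := by
    by_contra! hcon
    have := sum_nonpos fun i (_ : i ∈ univ) => hcon i
    linarith
  have hDpos : 0 < D := (Real.sqrt_pos.2 (hQpos i₀ hi₀)).trans_le
    (single_le_sum (f := fun t => √(Q t)) (fun _ _ => Real.sqrt_nonneg _) (mem_univ _))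
  -- The comparison vector has mass √(Q t)/D on the fibre i j = t. When `G2` is added, the factor √Q
  -- cancels and only (aW)²/D² remains.
  have G1 := sum_mul_log_le π (fun i => (a i * W i) ^ 2 / (√(Q (i j)) * D)) hπ0 hπ1
    (fun i => by positivity) (by
      rw [← sum_fiberwise univ (fun i : J → ι => i j)]
      have : ∀ t ∈ univ, ∑ i with i j = t, (a i * W i) ^ 2 / (√(Q (i j)) * D) = √(Q t) / D := by
        intro t _
        rw [sum_congr rfl (g := fun i => (a i * W i) ^ 2 / (√(Q t) * D))
          fun i hi => by rw [(mem_filter.1 hi).2], ← sum_div, ← div_div]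
        congr 1
        exact Real.div_sqrt
      rw [sum_congr rfl this, ← sum_div, ← hD, div_self hDpos.ne'])
    (fun i hi => by
      have := hapos i hi
      have := hWpos i hi
      have := Real.sqrt_pos.2 (hQpos i hi)
      positivity)
  have G2 := sum_mul_log_le (u j) (fun t => √(Q t) / D) (hu0 j) (hu1 j) (fun t => by positivity)
    (by rw [← sum_div, ← hD, div_self hDpos.ne'])
    (fun t ht => by
      obtain ⟨i, hi, hi'⟩ : ∃ i ∈ ({i | i j = t} : Finset (J → ι)), 0 < π i := by
        by_contra! hcon
        exact ht.not_ge (sum_nonpos hcon)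
      have := Real.sqrt_pos.2 (hQpos i hi')
      rw [(mem_filter.1 hi).2] at this
      positivity)
  rw [hmarg j, hmarg j] at G2
  -- Subadditivity of entropy: that of π is at most the sum of the marginal entropies, hence at most
  -- k times the largest.
  have G3 := sum_mul_log_le π (fun i => ∏ s, u s (i s)) hπ0 hπ1
    (fun i => prod_nonneg fun s _ => hu0 s _)
    (by rw [← Fintype.prod_sum]; simp [hu1])
    (fun i hi => prod_pos fun s _ => hpos i hi s)
  have E3 : ∑ i, π i * Real.log (∏ s, u s (i s)) = -∑ s, h s := by
    rw [hh, sum_neg_distrib, neg_neg, sum_comm]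
    refine sum_congr rfl fun i _ => ?_
    rcases (hπ0 i).eq_or_lt with h0 | h0
    · simp [← h0]
    · rw [Real.log_prod fun s _ => (hpos i h0 s).ne', mul_sum]
  have E12 (i) : π i * Real.log ((a i * W i) ^ 2 / (√(Q (i j)) * D)) +
      π i * Real.log (√(Q (i j)) / D) = 2 / ρ * (π i * Real.log (π i)) +
      π i * (2 / ρ * Real.log Z - 2 * Real.log D) +
      2 * ∑ l, r l * (π i * Real.log (u (bl l) (i (bl l)))) := by
    rcases (hπ0 i).eq_or_lt with h0 | h0
    · simp [← h0]
    · have ha' := hapos i h0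
      have hW' := hWpos i h0
      have hQ' := Real.sqrt_pos.2 (hQpos i h0)
      have e1 : Real.log (π i) = ρ * Real.log (a i) - Real.log Z := by
        rw [hπdef]
        simp only
        rw [Real.log_div (by positivity) hZpos.ne', Real.log_rpow ha']
      have e2 : Real.log (W i) = ∑ l, r l * Real.log (u (bl l) (i (bl l))) := by
        rw [hW]
        simp only
        rw [Real.log_prod fun l _ => (Real.rpow_pos_of_pos (hpos i h0 _) _).ne']
        exact sum_congr rfl fun l _ => Real.log_rpow (hpos i h0 _) _
      have e3 : ∑ l, r l * (π i * Real.log (u (bl l) (i (bl l)))) = π i * Real.log (W i) := by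
        rw [e2, mul_sum]
        exact sum_congr rfl fun l _ => by ring
      rw [e3, e1, Real.log_div (by positivity) (by positivity), Real.log_pow,
        Real.log_mul ha'.ne' hW'.ne', Real.log_mul hQ'.ne' hDpos.ne',
        Real.log_div hQ'.ne' hDpos.ne']
      push_cast
      field_simp
      ring
  have E12' := sum_congr (rfl : (univ : Finset (J → ι)) = univ) fun i _ => E12 i
  rw [sum_add_distrib, sum_add_distrib, sum_add_distrib, ← mul_sum, ← sum_mul, hπ1, ← mul_sum,
    sum_comm] at E12'
  have E4 : ∑ l, ∑ i, r l * (π i * Real.log (u (bl l) (i (bl l)))) = -∑ l, r l * h (bl l) := by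
    rw [hh, ← sum_neg_distrib]
    refine sum_congr rfl fun l _ => ?_
    rw [← mul_sum]
    ring
  rw [E4] at E12'
  have E5 : ∑ l, r l * h (bl l) ≤ (∑ l, r l) * h j := by
    rw [sum_mul]
    exact sum_le_sum fun l _ => mul_le_mul_of_nonneg_left (hj _) (hr l)
  have E6 : ∑ s, h s ≤ Fintype.card J * h j := by
    have := sum_le_sum fun s (_ : s ∈ univ) => hj s
    simpa using this
  have E7 : ∑ i, π i * Real.log (u j (i j)) = -h j := by simp [hh]
  rw [E3] at G3
  rw [E7] at G2
  set σ := ∑ l, r l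
  set P := ∑ i, π i * Real.log (π i)
  have hk : (0 : ℝ) < Fintype.card J := by exact_mod_cast Fintype.card_pos
  -- The choice of ρ enters here: k(2/ρ - 1) = 1 - 2σ makes the entropy terms cancel, and σ ≤ 1/2
  -- gives the sign needed to use the bound on the entropy of π.
  have hρ2 : 2 / ρ - 1 = (1 - 2 * σ) / Fintype.card J := by
    have : 2 / ρ = 2 * (1 / ρ) := by ring
    rw [this, hρ']
    field_simp
    ring
  have E8 : (2 / ρ - 1) * (-P) ≤ (1 - 2 * σ) * h j := by
    calc (2 / ρ - 1) * (-P) ≤ (2 / ρ - 1) * (Fintype.card J * h j) :=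
          mul_le_mul_of_nonneg_left (by linarith)
            (by rw [hρ2]; exact div_nonneg (by linarith) hk.le)
      _ = (1 - 2 * σ) * h j := by rw [hρ2]; field_simp
  have fin : 1 / ρ * Real.log Z ≤ Real.log D := by
    have h1 : 2 / ρ * Real.log Z = 2 * (1 / ρ * Real.log Z) := by ring
    rw [h1] at E12'
    have h2 : (2 / ρ - 1) * (-P) = P - 2 / ρ * P := by ring
    rw [h2] at E8
    linarith
  rw [← Real.log_rpow hZpos] at fin
  exact (Real.log_le_log_iff (Real.rpow_pos_of_pos hZpos _) hDpos).1 fin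

/-! ### Signs -/

/-- The sign `±1` encoded by a Boolean. -/
def sgn (𝕜 : Type*) [RCLike 𝕜] (b : Bool) : 𝕜 := if b then 1 else -1

section Signs

variable {𝕜 : Type*} [RCLike 𝕜]

@[simp] theorem norm_sgn (b : Bool) : ‖sgn 𝕜 b‖ = 1 := by
  cases b <;> simp [sgn]

@[simp] theorem sgn_mul_self (b : Bool) : sgn 𝕜 b * sgn 𝕜 b = 1 := by
  cases b <;> simp [sgn]

@[simp] theorem sgn_not (b : Bool) : sgn 𝕜 (!b) = -sgn 𝕜 b := by
  cases b <;> simp [sgn]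

/-- Orthogonality of the coordinates of a random sign vector. -/
theorem sum_sgn_mul_sgn {ι : Type*} [Fintype ι] [DecidableEq ι] (s t : ι) :
    ∑ e : ι → Bool, sgn 𝕜 (e s) * sgn 𝕜 (e t) =
      if s = t then (Fintype.card (ι → Bool) : 𝕜) else 0 := by
  split_ifs with h
  · subst h
    simp
  -- Flipping the sign at s negates the summand when s ≠ t.
  · have hinv : Function.Involutive fun e : ι → Bool => Function.update e s (!e s) := fun e => by
      simp
    have hflip := Equiv.sum_comp hinv.toPerm fun e : ι → Bool => sgn 𝕜 (e s) * sgn 𝕜 (e t)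
    simp only [Function.Involutive.coe_toPerm, Function.update_self, sgn_not,
      Function.update_of_ne (Ne.symm h), neg_mul, sum_neg_distrib] at hflip
    exact self_eq_neg.1 hflip.symm

end Signs

/-! ### Polarization -/

section Polarization

variable {𝕜 : Type*} [RCLike 𝕜] {J L ι : Type*} [Fintype J] [DecidableEq J] [Fintype L]
  [DecidableEq L] [Fintype ι] [DecidableEq ι]

theorem map_eq_sum_basis {p : L → ℝ≥0∞} [∀ l, Fact (1 ≤ p l)]
    (T : ContinuousMultilinearMap 𝕜 (fun l : L => PiLp (p l) (fun _ : ι => 𝕜)) 𝕜)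
    (y : L → ι → 𝕜) :
    T (fun l => WithLp.toLp (p l) (y l)) =
      ∑ h : L → ι, (∏ l, y l (h l)) * T fun l => WithLp.toLp (p l) (Pi.single (h l) 1) := by
  have hy : (fun l => WithLp.toLp (p l) (y l)) = fun l => ∑ t, y l t •
      (WithLp.toLp (p l) (Pi.single t 1) : PiLp (p l) (fun _ : ι => 𝕜)) := by
    funext l
    ext s
    simp [Pi.single_apply]
  rw [hy, T.map_sum]
  refine sum_congr rfl fun h _ => ?_
  rw [T.map_smul_univ fun l => y l (h l), smul_eq_mul]

/-- Restricting a multilinear form to repeated basis vectors does not increase its norm. -/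
theorem norm_sum_repeated_le {p : L → ℝ≥0∞} [∀ l, Fact (1 ≤ p l)]
    (T : ContinuousMultilinearMap 𝕜 (fun l : L => PiLp (p l) (fun _ : ι => 𝕜)) 𝕜)
    (bl : L → J) (hbl : Function.Surjective bl) (u : J → ι → ℝ) (hu : ∀ j t, 0 ≤ u j t)
    (hu1 : ∀ j, ∑ t, u j t ≤ 1) (z : J → ι → 𝕜) (hz : ∀ j t, ‖z j t‖ ≤ 1) :
    ‖∑ i : J → ι, T (fun l => WithLp.toLp (p l) (Pi.single (i (bl l)) 1)) *
      ((∏ l, u (bl l) (i (bl l)) ^ ((p l)⁻¹).toReal : ℝ) : 𝕜) * ∏ j, z j (i j)‖ ≤ ‖T‖ := by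
  -- f picks one representative position in each block.
  obtain ⟨f, hf⟩ := hbl.hasRightInverse
  set x : L → ι → 𝕜 := fun l t => ((u (bl l) t ^ ((p l)⁻¹).toReal : ℝ) : 𝕜) with hx
  set e : (L → ι) → 𝕜 := fun h => T fun l => WithLp.toLp (p l) (Pi.single (h l) 1) with he
  -- Every position carries its own random signs; the representative also carries z and the product
  -- of all the signs of its block. On indices constant on blocks each sign occurs twice and
  -- disappears.
  let y : (L → ι → Bool) → L → ι → 𝕜 := fun η l t => x l t * (sgn 𝕜 (η l t) *
    if l = f (bl l) then z (bl l) t * ∏ l' with bl l' = bl l, sgn 𝕜 (η l' t) else 1)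
  have hy (η) (l) (t) : ‖y η l t‖ ≤ u (bl l) t ^ ((p l)⁻¹).toReal := by
    have h0 : 0 ≤ u (bl l) t ^ ((p l)⁻¹).toReal := Real.rpow_nonneg (hu _ _) _
    simp only [y, hx, norm_mul, norm_sgn, one_mul, RCLike.norm_ofReal, abs_of_nonneg h0]
    refine mul_le_of_le_one_right h0 ?_
    split_ifs
    · simpa [norm_prod] using hz _ _
    · simp
  have hTy (η) : ‖T fun l => WithLp.toLp (p l) (y η l)‖ ≤ ‖T‖ := by
    refine (T.le_opNorm _).trans (mul_le_of_le_one_right (norm_nonneg _) ?_)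
    exact prod_le_one (fun _ _ => norm_nonneg _) fun l _ =>
      PiLp.norm_le_one_of_weight (p l) _ (u (bl l)) (hu _) (hu1 _) (hy η l)
  have hprod (η) (h : L → ι) : ∏ l, y η l (h l) = (∏ l, x l (h l)) * (∏ j, z j (h (f j))) *
      ∏ l, sgn 𝕜 (η l (h l)) * sgn 𝕜 (η l (h (f (bl l)))) := by
    have h1 : (∏ l, if l = f (bl l) then
        z (bl l) (h l) * ∏ l' with bl l' = bl l, sgn 𝕜 (η l' (h l)) else 1) =
        (∏ j, z j (h (f j))) * ∏ l, sgn 𝕜 (η l (h (f (bl l)))) := by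
      rw [← prod_fiberwise univ bl, ← prod_fiberwise univ bl fun l => sgn 𝕜 (η l (h (f (bl l)))),
        ← prod_mul_distrib]
      refine prod_congr rfl fun j _ => ?_
      rw [prod_eq_single (f j)]
      · rw [hf j, if_pos rfl]
        congr 1
        exact prod_congr rfl fun l hl => by rw [(mem_filter.1 hl).2]
      · intro l hl hne
        rw [(mem_filter.1 hl).2, if_neg hne]
      · intro hn
        exact absurd (by simp [hf j]) hn
    simp only [y]
    rw [prod_mul_distrib, prod_mul_distrib, h1, prod_mul_distrib]
    ring
  have havg : ∑ η : L → ι → Bool, T (fun l => WithLp.toLp (p l) (y η l)) =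
      (Fintype.card (L → ι → Bool) : 𝕜) * ∑ i : J → ι, e (fun l => i (bl l)) *
        ((∏ l, u (bl l) (i (bl l)) ^ ((p l)⁻¹).toReal : ℝ) : 𝕜) * ∏ j, z j (i j) := by
    rw [sum_congr rfl fun η _ => map_eq_sum_basis T (y η)]
    simp_rw [hprod]
    rw [sum_comm]
    -- The signs at different positions are independent, so one position disagreeing with its
    -- representative annihilates the average.
    have h2 (h : L → ι) : ∑ η : L → ι → Bool, (∏ l, x l (h l)) * (∏ j, z j (h (f j))) *
        (∏ l, sgn 𝕜 (η l (h l)) * sgn 𝕜 (η l (h (f (bl l))))) * e h =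
        if ∀ l, h l = h (f (bl l)) then (Fintype.card (L → ι → Bool) : 𝕜) *
          (e h * (∏ l, x l (h l)) * ∏ j, z j (h (f j))) else 0 := by
      rw [← sum_mul, ← mul_sum, ← Fintype.prod_sum
        fun l (η : ι → Bool) => sgn 𝕜 (η (h l)) * sgn 𝕜 (η (h (f (bl l))))]
      simp_rw [sum_sgn_mul_sgn]
      split_ifs with hc
      · rw [prod_congr rfl fun l _ => if_pos (hc l)]
        simp
        ring
      · push Not at hc
        obtain ⟨l, hl⟩ := hc
        have h0 : ∏ l, (if h l = h (f (bl l)) then (Fintype.card (ι → Bool) : 𝕜) else 0) = 0 :=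
          prod_eq_zero (mem_univ l) (if_neg hl)
        rw [h0, mul_zero, zero_mul]
    rw [sum_congr rfl fun h _ => h2 h, ← sum_filter, mul_sum]
    refine sum_nbij' (fun h j => h (f j)) (fun i l => i (bl l)) (by simp) ?_ ?_ ?_ ?_
    · intro i _
      simp [hf _]
    · intro h hh
      funext l
      exact ((mem_filter.1 hh).2 l).symm
    · intro i _
      funext j
      simp [hf j]
    · intro h hh
      have hh' (l) : h (f (bl l)) = h l := ((mem_filter.1 hh).2 l).symm
      simp only [hh', RCLike.ofReal_prod, hx]
  have hcard : (0 : ℝ) < Fintype.card (L → ι → Bool) := by exact_mod_cast Fintype.card_pos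
  have hle := norm_sum_le univ fun η : L → ι → Bool => T (fun l => WithLp.toLp (p l) (y η l))
  rw [havg, norm_mul, RCLike.norm_natCast] at hle
  have hle2 := hle.trans (sum_le_sum fun η _ => hTy η)
  rw [sum_const, card_univ, nsmul_eq_mul] at hle2
  exact le_of_mul_le_mul_left hle2 hcard

end Polarization

/-! ### Khinchine's inequality -/

theorem sum_fin_succ_pi {n : ℕ} {α M : Type*} [Fintype α] [AddCommMonoid M]
    (F : (Fin (n + 1) → α) → M) :
    ∑ e, F e = ∑ b : α, ∑ e : Fin n → α, F (Fin.cons b e) := by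
  rw [← Equiv.sum_comp (Fin.consEquiv fun _ => α), Fintype.sum_prod_type]
  rfl

theorem sum_fin_insertNth {n : ℕ} {α M : Type*} [Fintype α] [AddCommMonoid M] (j : Fin (n + 1))
    (F : (Fin (n + 1) → α) → M) :
    ∑ i, F i = ∑ t, ∑ i : Fin n → α, F (j.insertNth t i) := by
  rw [← Equiv.sum_comp (Fin.insertNthEquiv (fun _ => α) j), Fintype.sum_prod_type]
  rfl

section Khinchine

variable {𝕜 E : Type*} [RCLike 𝕜] [NormedAddCommGroup E] [InnerProductSpace 𝕜 E]

/-- With S = ‖x‖² + ‖y‖² and R = Re⟨x, y⟩ the left side is (S + 2R)² + (S - 2R)² = 2S² + 8R²;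
Cauchy–Schwarz bounds R. -/
theorem norm_add_pow_four_add_norm_sub_pow_four_le (𝕜 : Type*) {E : Type*} [RCLike 𝕜]
    [NormedAddCommGroup E] [InnerProductSpace 𝕜 E] (x y : E) :
    ‖x + y‖ ^ 4 + ‖-x + y‖ ^ 4 ≤
      2 * (‖x‖ ^ 2) ^ 2 + 12 * (‖x‖ ^ 2 * ‖y‖ ^ 2) + 2 * ‖y‖ ^ 4 := by
  have h1 := norm_add_sq (𝕜 := 𝕜) x y
  have h2 := norm_add_sq (𝕜 := 𝕜) (-x) y
  rw [inner_neg_left, map_neg, norm_neg] at h2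
  set R := RCLike.re (inner 𝕜 x y)
  have h3 : |R| ≤ ‖x‖ * ‖y‖ := (RCLike.abs_re_le_norm _).trans (norm_inner_le_norm x y)
  have h4 : R ^ 2 ≤ ‖x‖ ^ 2 * ‖y‖ ^ 2 := by
    rw [← mul_pow, ← sq_abs]
    exact pow_le_pow_left₀ (abs_nonneg _) h3 2
  have e1 : ‖x + y‖ ^ 4 = (‖x + y‖ ^ 2) ^ 2 := by ring
  have e2 : ‖-x + y‖ ^ 4 = (‖-x + y‖ ^ 2) ^ 2 := by ring
  rw [e1, e2, h1, h2]
  nlinarith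

theorem sum_norm_signed_sum_sq {n : ℕ} (v : Fin n → E) :
    ∑ e : Fin n → Bool, ‖∑ i, sgn 𝕜 (e i) • v i‖ ^ 2 = 2 ^ n * ∑ i, ‖v i‖ ^ 2 := by
  induction n with
  | zero => simp
  | succ n ih =>
    rw [sum_fin_succ_pi, Fintype.sum_bool, ← sum_add_distrib]
    simp only [Fin.sum_univ_succ, Fin.cons_zero, Fin.cons_succ]
    have key (X : E) : ‖sgn 𝕜 true • v 0 + X‖ ^ 2 + ‖sgn 𝕜 false • v 0 + X‖ ^ 2 =
        2 * ‖v 0‖ ^ 2 + 2 * ‖X‖ ^ 2 := by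
      have h1 := norm_add_sq (𝕜 := 𝕜) (v 0) X
      have h2 := norm_add_sq (𝕜 := 𝕜) (-v 0) X
      rw [inner_neg_left, map_neg, norm_neg] at h2
      simp only [sgn, if_true, one_smul, Bool.false_eq_true, if_false, neg_smul]
      rw [h1, h2]
      ring
    simp only [key]
    rw [sum_add_distrib, ← mul_sum, ← mul_sum, ih]
    simp
    ring

/-- The constant 3 survives the induction because the cross term 12‖v 0‖²‖X‖², averaged over the
other signs, is exactly the cross term of 3(∑‖v i‖²)². -/
theorem sum_norm_signed_sum_pow_four_le {n : ℕ} (v : Fin n → E) :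
    ∑ e : Fin n → Bool, ‖∑ i, sgn 𝕜 (e i) • v i‖ ^ 4 ≤ 2 ^ n * (3 * (∑ i, ‖v i‖ ^ 2) ^ 2) := by
  induction n with
  | zero => simp
  | succ n ih =>
    rw [sum_fin_succ_pi, Fintype.sum_bool, ← sum_add_distrib]
    simp only [Fin.sum_univ_succ, Fin.cons_zero, Fin.cons_succ]
    have key (X : E) : ‖sgn 𝕜 true • v 0 + X‖ ^ 4 + ‖sgn 𝕜 false • v 0 + X‖ ^ 4 ≤
        2 * (‖v 0‖ ^ 2) ^ 2 + 12 * ‖v 0‖ ^ 2 * ‖X‖ ^ 2 + 2 * ‖X‖ ^ 4 := by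
      simp only [sgn, if_true, one_smul, Bool.false_eq_true, if_false, neg_smul]
      exact (norm_add_pow_four_add_norm_sub_pow_four_le 𝕜 (v 0) X).trans_eq (by ring)
    refine (sum_le_sum fun e _ => key _).trans ?_
    rw [sum_add_distrib, sum_add_distrib, ← mul_sum, ← mul_sum, ← mul_sum, sum_norm_signed_sum_sq]
    have h := ih fun i => v i.succ
    simp only [sum_const, card_univ, Fintype.card_fun, Fintype.card_bool, Fintype.card_fin,
      nsmul_eq_mul, Nat.cast_pow, Nat.cast_ofNat, pow_succ (2 : ℝ) n]
    set S := ∑ i : Fin n, ‖v i.succ‖ ^ 2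
    have h2 : (0 : ℝ) < 2 ^ n := by positivity
    nlinarith [mul_nonneg h2.le (sq_nonneg (‖v 0‖ ^ 2))]

/-- Khinchine's inequality between the first and the second moment, in a Hilbert space. -/
theorem khinchine {n : ℕ} (v : Fin n → E) :
    2 ^ n * √(∑ i, ‖v i‖ ^ 2) ≤ √3 * ∑ e : Fin n → Bool, ‖∑ i, sgn 𝕜 (e i) • v i‖ := by
  have hs : 0 ≤ ∑ i, ‖v i‖ ^ 2 := by positivity
  rcases hs.eq_or_lt with h0 | hpos
  · rw [← h0]
    simp only [Real.sqrt_zero, mul_zero]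
    positivity
  have h2 := sum_norm_signed_sum_sq (𝕜 := 𝕜) v
  have h4 := sum_norm_signed_sum_pow_four_le (𝕜 := 𝕜) v
  set s := ∑ i, ‖v i‖ ^ 2
  -- c² = 3s is the ratio of the fourth-moment bound to the second moment. In `key`, the cubic
  -- factor has a double root at c, which yields the same constant as Hölder between the moments 1,
  -- 2 and 4.
  set c := √3 * √s with hc
  have hc2 : c ^ 2 = 3 * s := by rw [hc, mul_pow, Real.sq_sqrt (by norm_num), Real.sq_sqrt hs]
  have hcpos : 0 < c := by positivity
  have key (X : ℝ) (hX : 0 ≤ X) : 3 * c ^ 2 * X ^ 2 ≤ 2 * c ^ 3 * X + X ^ 4 := by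
    have : 0 ≤ X * ((X - c) ^ 2 * (X + 2 * c)) := by positivity
    nlinarith
  have hsum := sum_le_sum fun (e : Fin n → Bool) (_ : e ∈ univ) =>
    key ‖∑ i, sgn 𝕜 (e i) • v i‖ (norm_nonneg _)
  rw [sum_add_distrib, ← mul_sum, ← mul_sum, h2] at hsum
  set S1 := ∑ e : Fin n → Bool, ‖∑ i, sgn 𝕜 (e i) • v i‖
  have h5 : 2 ^ n * (s * (3 * s)) ≤ c * (3 * s) * S1 := by
    have e1 : c ^ 3 = c * (3 * s) := by rw [← hc2]; ring
    rw [hc2, e1] at hsum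
    nlinarith
  have h6 : 2 ^ n * s ≤ c * S1 := by
    have : (2 ^ n * s) * (3 * s) ≤ (c * S1) * (3 * s) := by linarith
    exact le_of_mul_le_mul_right this (by positivity)
  have h7 : (2 ^ n * √s) * √s ≤ (√3 * S1) * √s := by
    rw [mul_assoc, Real.mul_self_sqrt hs]
    exact h6.trans_eq (by rw [hc]; ring)
  exact le_of_mul_le_mul_right h7 (Real.sqrt_pos.2 hpos)

/-- Khinchine's inequality for decoupled Rademacher chaoses. -/
theorem khinchine_chaos {N d : ℕ} (c : (Fin d → Fin N) → 𝕜) :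
    (2 ^ N) ^ d * √(∑ i, ‖c i‖ ^ 2) ≤ √3 ^ d * ∑ e : Fin d → Fin N → Bool,
      ‖∑ i : Fin d → Fin N, (∏ s, sgn 𝕜 (e s (i s))) * c i‖ := by
  induction d with
  | zero => simp
  | succ d ih =>
    -- One variable is randomized at a time, the rest being kept as a vector in ℓ_2; this is why a
    -- Hilbert-space version is needed.
    have h1 := khinchine (𝕜 := 𝕜) fun t : Fin N =>
      (WithLp.toLp 2 fun i : Fin d → Fin N => c (Fin.cons t i) :
        PiLp 2 fun _ : Fin d → Fin N => 𝕜)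
    have h2 (e : Fin N → Bool) : ‖∑ t, sgn 𝕜 (e t) •
        (WithLp.toLp 2 fun i : Fin d → Fin N => c (Fin.cons t i) :
          PiLp 2 fun _ : Fin d → Fin N => 𝕜)‖ =
        √(∑ i : Fin d → Fin N, ‖∑ t, sgn 𝕜 (e t) * c (Fin.cons t i)‖ ^ 2) := by
      rw [PiLp.norm_eq_of_L2]
      simp
    simp only [h2, PiLp.norm_sq_eq_of_L2] at h1
    rw [sum_fin_succ_pi]
    have h3 (e : Fin N → Bool) := ih fun i => ∑ t, sgn 𝕜 (e t) * c (Fin.cons t i)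
    calc (2 ^ N) ^ (d + 1) * √(∑ t, ∑ i : Fin d → Fin N, ‖c (Fin.cons t i)‖ ^ 2)
        = (2 ^ N) ^ d * (2 ^ N * √(∑ t, ∑ i : Fin d → Fin N, ‖c (Fin.cons t i)‖ ^ 2)) := by ring
      _ ≤ (2 ^ N) ^ d * (√3 * ∑ e : Fin N → Bool,
            √(∑ i : Fin d → Fin N, ‖∑ t, sgn 𝕜 (e t) * c (Fin.cons t i)‖ ^ 2)) :=
          mul_le_mul_of_nonneg_left h1 (by positivity)
      _ = √3 * ∑ e : Fin N → Bool, (2 ^ N) ^ d *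
            √(∑ i : Fin d → Fin N, ‖∑ t, sgn 𝕜 (e t) * c (Fin.cons t i)‖ ^ 2) := by
          rw [← mul_sum]
          ring
      _ ≤ √3 * ∑ e : Fin N → Bool, √3 ^ d * ∑ e' : Fin d → Fin N → Bool,
            ‖∑ i : Fin d → Fin N, (∏ s, sgn 𝕜 (e' s (i s))) *
              ∑ t, sgn 𝕜 (e t) * c (Fin.cons t i)‖ :=
          mul_le_mul_of_nonneg_left (sum_le_sum fun e _ => h3 e) (by positivity)
      _ = _ := by
          rw [← mul_sum, ← mul_assoc, pow_succ' (√3) d, sum_fin_succ_pi]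
          congr 1
          refine sum_congr rfl fun e _ => sum_congr rfl fun e' _ => ?_
          rw [sum_fin_succ_pi, sum_comm]
          congr 1
          refine sum_congr rfl fun i _ => ?_
          rw [mul_sum]
          refine sum_congr rfl fun t _ => ?_
          rw [Fin.prod_univ_succ]
          simp only [Fin.cons_zero, Fin.cons_succ]
          ring

/-- Mixed `(1, 2)`-norm estimate for the coefficients of a form bounded on products of
`ℓ_∞`-balls. -/
theorem sum_sqrt_fiber_le {N d : ℕ} (c : (Fin (d + 1) → Fin N) → 𝕜) (K : ℝ)
    (H : ∀ z : Fin (d + 1) → Fin N → 𝕜, (∀ j t, ‖z j t‖ ≤ 1) → ‖∑ i, c i * ∏ j, z j (i j)‖ ≤ K)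
    (j : Fin (d + 1)) :
    ∑ t, √(∑ i with i j = t, ‖c i‖ ^ 2) ≤ √3 ^ d * K := by
  have hfib (t : Fin N) : ∑ i with i j = t, ‖c i‖ ^ 2 =
      ∑ i : Fin d → Fin N, ‖c (j.insertNth t i)‖ ^ 2 := by
    rw [sum_filter, sum_fin_insertNth j, sum_eq_single t]
    · simp
    · intro b _ hb
      simp [hb]
    · simp
  simp_rw [hfib]
  have hpow : (0 : ℝ) < (2 ^ N) ^ d := by positivity
  refine le_of_mul_le_mul_left ?_ hpow
  rw [mul_sum]
  refine (sum_le_sum fun t _ => khinchine_chaos fun i => c (j.insertNth t i)).trans ?_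
  rw [← mul_sum, sum_comm, ← mul_assoc, mul_comm ((2 ^ N : ℝ) ^ d), mul_assoc]
  refine mul_le_mul_of_nonneg_left ?_ (by positivity)
  have hcard : (2 ^ N : ℝ) ^ d * K = ∑ _e : Fin d → Fin N → Bool, K := by
    simp
  rw [hcard]
  refine sum_le_sum fun e _ => ?_
  set G : Fin N → 𝕜 := fun t =>
    ∑ i : Fin d → Fin N, (∏ s, sgn 𝕜 (e s (i s))) * c (j.insertNth t i) with hG
  -- With the signs of the other variables fixed, phases in the j-th variable turn the form into ∑
  -- |G t|.
  have hθ (t) : ∃ θ : 𝕜, ‖θ‖ ≤ 1 ∧ θ * G t = (‖G t‖ : 𝕜) := by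
    obtain ⟨θ, h1, h2⟩ := RCLike.exists_norm_eq_mul_self (G t)
    exact ⟨θ, h1.le, h2.symm⟩
  choose θ hθ1 hθ2 using hθ
  have hz := H (j.insertNth θ fun s t => sgn 𝕜 (e s t)) (by
    intro s t
    refine Fin.succAboveCases j ?_ (fun s => ?_) s
    · simpa using hθ1 t
    · simp)
  rw [sum_fin_insertNth j] at hz
  have hre : ∑ t, ∑ i : Fin d → Fin N, c (j.insertNth t i) *
      ∏ s, (j.insertNth θ fun s t => sgn 𝕜 (e s t) : Fin (d + 1) → Fin N → 𝕜) s
        ((j.insertNth t i : Fin (d + 1) → Fin N) s) = ((∑ t, ‖G t‖ : ℝ) : 𝕜) := by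
    rw [RCLike.ofReal_sum]
    refine sum_congr rfl fun t _ => ?_
    rw [← hθ2 t, hG, mul_sum]
    refine sum_congr rfl fun i _ => ?_
    rw [Fin.prod_univ_succAbove _ j]
    simp only [Fin.insertNth_apply_same, Fin.insertNth_apply_succAbove]
    ring
  rw [hre, RCLike.norm_ofReal, abs_of_nonneg (by positivity)] at hz
  exact hz

end Khinchine

/-! ### The upper bound -/

theorem recipSum_nonneg {m : ℕ} (p : Fin m → ℝ≥0∞) : 0 ≤ recipSum p :=
  sum_nonneg fun _ _ => ENNReal.toReal_nonneg

theorem block_surjective {k m : ℕ} (n : Fin k → ℕ) (hn1 : ∀ j, 1 ≤ n j) (hn : ∑ j, n j = m) :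
    Function.Surjective (block n hn) := fun j =>
  ⟨Fin.cast hn (finSigmaFinEquiv ⟨j, ⟨0, hn1 j⟩⟩), by simp [block]⟩

theorem inequality_of_recipSum_le {𝕜 : Type*} [RCLike 𝕜] {d m : ℕ} (p : Fin m → ℝ≥0∞)
    [∀ l, Fact (1 ≤ p l)] (hp : recipSum p ≤ 1 / 2) (n : Fin (d + 1) → ℕ) (hn1 : ∀ j, 1 ≤ n j)
    (hn : ∑ j, n j = m) :
    Inequality 𝕜 p n hn (2 * ((d + 1 : ℕ) : ℝ) / ((d + 1 : ℕ) + 1 - 2 * recipSum p))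
      (√3 ^ d) := by
  intro N _ T
  have h0 := recipSum_nonneg p
  have hd : (0 : ℝ) < ((d + 1 : ℕ) : ℝ) := by positivity
  have hden : 0 < ((d + 1 : ℕ) : ℝ) + 1 - 2 * recipSum p := by linarith
  refine rpow_sum_rpow_le_of_mixed (block n hn) (fun l => ((p l)⁻¹).toReal)
    (fun _ => ENNReal.toReal_nonneg) hp (fun i => ‖T (repeatedBasis 𝕜 p n hn i)‖)
    (fun _ => norm_nonneg _) _ _ (by positivity) (div_pos (by positivity) hden) ?_ ?_
  · rw [one_div_div, Fintype.card_fin]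
    rfl
  · intro u hu hu1 j
    have := sum_sqrt_fiber_le (fun i => T (repeatedBasis 𝕜 p n hn i) *
      ((∏ l, u (block n hn l) (i (block n hn l)) ^ ((p l)⁻¹).toReal : ℝ) : 𝕜)) ‖T‖
      (fun z hz => norm_sum_repeated_le T (block n hn) (block_surjective n hn1 hn) u hu
        (fun j => (hu1 j).le) z hz) j
    refine le_trans (le_of_eq ?_) this
    refine sum_congr rfl fun t _ => ?_
    congr 1
    refine sum_congr rfl fun i _ => ?_
    rw [norm_mul, RCLike.norm_ofReal, abs_of_nonneg]
    exact prod_nonneg fun l _ => Real.rpow_nonneg (hu _ _) _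

/-! ### Forms given by their coefficients -/

section TensorForm

variable {𝕜 : Type*} [RCLike 𝕜] {m N : ℕ} (p : Fin m → ℝ≥0∞)

/-- The `m`-linear form with coefficients `c`. -/
def tensorForm (c : (Fin m → Fin N) → 𝕜) :
    ContinuousMultilinearMap 𝕜 (fun l : Fin m => PiLp (p l) (fun _ : Fin N => 𝕜)) 𝕜 :=
  ∑ h : Fin m → Fin N, c h •
    (ContinuousMultilinearMap.mkPiAlgebra 𝕜 (Fin m) 𝕜).compContinuousLinearMap fun l =>
      PiLp.proj (𝕜 := 𝕜) (p l) (fun _ : Fin N => 𝕜) (h l)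

theorem tensorForm_apply (c : (Fin m → Fin N) → 𝕜) (x : ∀ l, PiLp (p l) (fun _ : Fin N => 𝕜)) :
    tensorForm p c x = ∑ h, c h * ∏ l, x l (h l) := by
  simp [tensorForm]

theorem tensorForm_repeatedBasis {k : ℕ} (c : (Fin m → Fin N) → 𝕜) (n : Fin k → ℕ)
    (hn : ∑ j, n j = m) (i : Fin k → Fin N) :
    tensorForm p c (repeatedBasis 𝕜 p n hn i) = c fun l => i (block n hn l) := by
  rw [tensorForm_apply, sum_eq_single fun l => i (block n hn l)]
  · simp [repeatedBasis]
  · intro h _ hne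
    obtain ⟨l, hl⟩ := Function.ne_iff.1 hne
    rw [prod_eq_zero (mem_univ l), mul_zero]
    simp [repeatedBasis, hl]
  · simp

variable {p} in
theorem opNorm_le_of_unit_ball [∀ l, Fact (1 ≤ p l)]
    (T : ContinuousMultilinearMap 𝕜 (fun l : Fin m => PiLp (p l) (fun _ : Fin N => 𝕜)) 𝕜) (B : ℝ)
    (hB : 0 ≤ B) (h : ∀ x, (∀ l, ‖x l‖ ≤ 1) → ‖T x‖ ≤ B) : ‖T‖ ≤ B := by
  refine T.opNorm_le_bound hB fun x => ?_
  by_cases h0 : ∃ l, x l = 0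
  · obtain ⟨l, hl⟩ := h0
    rw [T.map_coord_zero l hl, norm_zero]
    positivity
  · push Not at h0
    have hx : x = fun l => (‖x l‖ : 𝕜) • ((‖x l‖ : 𝕜)⁻¹ • x l) := by
      funext l
      rw [smul_inv_smul₀]
      simpa using h0 l
    have h1 := h (fun l => (‖x l‖ : 𝕜)⁻¹ • x l) fun l => by
      rw [norm_smul, norm_inv, RCLike.norm_ofReal, abs_norm, inv_mul_cancel₀]
      simpa using h0 l
    have h2 : T x = (∏ l, (‖x l‖ : 𝕜)) • T fun l => (‖x l‖ : 𝕜)⁻¹ • x l := by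
      conv_lhs => rw [hx]
      exact T.map_smul_univ _ _
    rw [h2, norm_smul, norm_prod, mul_comm]
    simp only [RCLike.norm_ofReal, abs_norm]
    exact mul_le_mul_of_nonneg_right h1 (by positivity)

end TensorForm

/-! ### Lower bounds from families of forms -/

/-- A logarithmic loss does not affect exponents, so a crude union bound suffices for the random
form. -/
theorem le_of_rpow_le_log_mul_rpow {α β B : ℝ}
    (h : ∀ N : ℕ, 1 ≤ N → (N : ℝ) ^ α ≤ B * ((1 + Real.log N) * (N : ℝ) ^ β)) : α ≤ β := by
  by_contra! hlt
  have hδ : 0 < α - β := sub_pos.2 hlt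
  have h1 : Filter.Tendsto (fun x : ℝ => x ^ (-(α - β)) + Real.log x / x ^ (α - β)) Filter.atTop
      (nhds (0 + 0)) :=
    (tendsto_rpow_neg_atTop hδ).add (isLittleO_log_rpow_atTop hδ).tendsto_div_nhds_zero
  have h2 := ((h1.comp tendsto_natCast_atTop_atTop).const_mul B)
  rw [add_zero, mul_zero] at h2
  refine (ge_of_tendsto h2 (b := 1) ?_).not_gt zero_lt_one
  filter_upwards [Filter.eventually_ge_atTop 1] with N hN
  have hN0 : (0 : ℝ) < N := by exact_mod_cast hN
  have h3 := h N hN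
  have h4 : (N : ℝ) ^ α = (N : ℝ) ^ (α - β) * (N : ℝ) ^ β := by
    rw [← Real.rpow_add hN0, sub_add_cancel]
  have hb := Real.rpow_pos_of_pos hN0 β
  have hd := Real.rpow_pos_of_pos hN0 (α - β)
  rw [h4, ← mul_assoc] at h3
  have h5 := le_of_mul_le_mul_right h3 hb
  simp only [Function.comp_apply]
  rw [Real.rpow_neg hN0.le, inv_eq_one_div, ← add_div, ← mul_div_assoc, le_div_iff₀ hd, one_mul]
  exact h5

theorem div_le_of_inequality {𝕜 : Type*} [RCLike 𝕜] {k m : ℕ} {p : Fin m → ℝ≥0∞}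
    [∀ l, Fact (1 ≤ p l)] {n : Fin k → ℕ} {hn : ∑ j, n j = m} {ρ C : ℝ} (hρ : 0 < ρ)
    (hC : Inequality 𝕜 p n hn ρ C) (A κ β : ℝ)
    (h : ∀ N : ℕ, 1 ≤ N → ∃ T : ContinuousMultilinearMap 𝕜
      (fun l : Fin m => PiLp (p l) (fun _ : Fin N => 𝕜)) 𝕜,
      ‖T‖ ≤ A * ((1 + Real.log N) * (N : ℝ) ^ β) ∧
      (N : ℝ) ^ κ ≤ ∑ i : Fin k → Fin N, ‖T (repeatedBasis 𝕜 p n hn i)‖ ^ ρ) :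
    κ / ρ ≤ β := by
  refine le_of_rpow_le_log_mul_rpow (B := |C| * A) fun N hN => ?_
  obtain ⟨T, hT, hs⟩ := h N hN
  calc (N : ℝ) ^ (κ / ρ) = ((N : ℝ) ^ κ) ^ (1 / ρ) := by
        rw [← Real.rpow_mul (Nat.cast_nonneg N)]
        ring_nf
    _ ≤ (∑ i : Fin k → Fin N, ‖T (repeatedBasis 𝕜 p n hn i)‖ ^ ρ) ^ (1 / ρ) :=
        Real.rpow_le_rpow (by positivity) hs (by positivity)
    _ ≤ C * ‖T‖ := hC N hN T
    _ ≤ |C| * ‖T‖ := mul_le_mul_of_nonneg_right (le_abs_self C) (norm_nonneg _)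
    _ ≤ |C| * (A * ((1 + Real.log N) * (N : ℝ) ^ β)) :=
        mul_le_mul_of_nonneg_left hT (abs_nonneg C)
    _ = _ := by ring

/-! ### The diagonal form -/

theorem sum_filter_const {K ι M : Type*} [Nonempty K] [Fintype K] [DecidableEq K] [Fintype ι]
    [DecidablePred fun i : K → ι => ∃ t, i = fun _ => t] [AddCommMonoid M] (F : (K → ι) → M) :
    ∑ i with ∃ t, i = fun _ => t, F i = ∑ t, F fun _ => t := by
  symm
  refine sum_bij (fun t _ _ => t) (fun t _ => by simpa using ⟨t, rfl⟩) ?_ ?_ (by simp)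
  · intro s _ t _ hst
    exact congr_fun hst (Classical.arbitrary K)
  · intro i hi
    obtain ⟨t, rfl⟩ := (mem_filter.1 hi).2
    exact ⟨t, mem_univ _, rfl⟩

/-- The coefficients are 1 on constant multi-indices and 0 elsewhere; the norm bound is Hölder's
inequality for the weights. -/
theorem exists_diagonal_form {𝕜 : Type*} [RCLike 𝕜] {k m : ℕ} (hk : 1 ≤ k) (p : Fin m → ℝ≥0∞)
    [∀ l, Fact (1 ≤ p l)] (hp : recipSum p ≤ 1) (n : Fin k → ℕ) (hn1 : ∀ j, 1 ≤ n j)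
    (hn : ∑ j, n j = m) (ρ : ℝ) (N : ℕ) (hN : 1 ≤ N) :
    ∃ T : ContinuousMultilinearMap 𝕜 (fun l : Fin m => PiLp (p l) (fun _ : Fin N => 𝕜)) 𝕜,
      ‖T‖ ≤ (N : ℝ) ^ (1 - recipSum p) ∧
      (N : ℝ) ≤ ∑ i : Fin k → Fin N, ‖T (repeatedBasis 𝕜 p n hn i)‖ ^ ρ := by
  have : NeZero N := ⟨by omega⟩
  obtain ⟨j₀⟩ : Nonempty (Fin k) := ⟨⟨0, hk⟩⟩
  obtain ⟨l₀, -⟩ := block_surjective n hn1 hn j₀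
  have : Nonempty (Fin m) := ⟨l₀⟩
  refine ⟨tensorForm p fun h => if ∃ t, h = fun _ => t then 1 else 0, ?_, ?_⟩
  · refine opNorm_le_of_unit_ball _ _ (by positivity) fun x hx => ?_
    choose u hu hu1 hux using fun l => PiLp.exists_weight (p l) (x l) (hx l)
    rw [tensorForm_apply]
    simp only [ite_mul, one_mul, zero_mul]
    rw [← sum_filter, sum_filter_const]
    refine (norm_sum_le _ _).trans ?_
    refine le_trans (sum_le_sum fun t _ => ?_) ((sum_prod_rpow_le_card_rpow u hu hu1
      (fun l => ((p l)⁻¹).toReal) (fun _ => ENNReal.toReal_nonneg) hp).trans_eq ?_)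
    · rw [norm_prod]
      exact prod_le_prod (fun _ _ => norm_nonneg _) fun l _ => hux l t
    · rw [Fintype.card_fin]
      rfl
  · have h1 : (N : ℝ) = ∑ i : Fin k → Fin N with ∃ t, i = fun _ => t, (1 : ℝ) := by
      have : Nonempty (Fin k) := ⟨j₀⟩
      rw [sum_filter_const]
      simp
    rw [h1]
    refine (sum_le_sum fun i hi => ?_).trans (sum_le_sum_of_subset_of_nonneg (subset_univ _)
      fun i _ _ => by positivity)
    obtain ⟨t, rfl⟩ := (mem_filter.1 hi).2
    rw [tensorForm_repeatedBasis, if_pos ⟨t, rfl⟩]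
    simp

/-! ### Random signs -/

/-- Exponential moments: cosh x ≤ exp(x²/2) bounds the average over signs of exp(s|∑|) for each ω,
and some choice of signs does no worse than average on the sum over ω. The parameter s stays free.
-/
theorem exists_signs_abs_sum_le {Ω H : Type*} [Fintype Ω] [Fintype H] (c : Ω → H → ℝ) (V s G : ℝ)
    (hV : ∀ ω, ∑ h, c ω h ^ 2 ≤ V) (hs : 0 < s) (hG : 2 * (Fintype.card Ω : ℝ) ≤ G)
    (hG0 : 0 < G) :
    ∃ e : H → Bool, ∀ ω, |∑ h, sgn ℝ (e h) * c ω h| ≤ Real.log G / s + s * V / 2 := by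
  classical
  have hexp (a : ℝ) (ω : Ω) (ha : a ^ 2 = s ^ 2) :
      ∑ e : H → Bool, Real.exp (a * ∑ h, sgn ℝ (e h) * c ω h) ≤
        (Fintype.card (H → Bool) : ℝ) * Real.exp (s ^ 2 * V / 2) := by
    calc ∑ e : H → Bool, Real.exp (a * ∑ h, sgn ℝ (e h) * c ω h)
        = ∑ e : H → Bool, ∏ h, Real.exp (a * (sgn ℝ (e h) * c ω h)) := by
          simp_rw [mul_sum, Real.exp_sum]
      _ = ∏ h, ∑ b : Bool, Real.exp (a * (sgn ℝ b * c ω h)) :=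
          (Fintype.prod_sum fun h b => Real.exp (a * (sgn ℝ b * c ω h))).symm
      _ = ∏ h, 2 * Real.cosh (a * c ω h) := by
          refine prod_congr rfl fun h _ => ?_
          rw [Fintype.sum_bool, Real.cosh_eq]
          simp [sgn]
          ring
      _ ≤ ∏ h, 2 * Real.exp ((a * c ω h) ^ 2 / 2) :=
          prod_le_prod (fun h _ => by positivity) fun h _ =>
            mul_le_mul_of_nonneg_left (Real.cosh_le_exp_half_sq _) two_pos.le
      _ = (Fintype.card (H → Bool) : ℝ) * Real.exp (s ^ 2 * (∑ h, c ω h ^ 2) / 2) := by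
          rw [prod_mul_distrib, ← Real.exp_sum, mul_sum, sum_div]
          simp [mul_pow, ha]
      _ ≤ _ := by
          have := hV ω
          gcongr
  have htot : ∑ e : H → Bool, ∑ ω, Real.exp (s * |∑ h, sgn ℝ (e h) * c ω h|) ≤
      ∑ _e : H → Bool, G * Real.exp (s ^ 2 * V / 2) := by
    rw [sum_comm, sum_const, card_univ, nsmul_eq_mul]
    calc ∑ ω, ∑ e : H → Bool, Real.exp (s * |∑ h, sgn ℝ (e h) * c ω h|)
        ≤ ∑ _ω : Ω, 2 * ((Fintype.card (H → Bool) : ℝ) * Real.exp (s ^ 2 * V / 2)) := by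
          refine sum_le_sum fun ω _ => ?_
          rw [two_mul]
          refine le_trans ?_ (add_le_add (hexp s ω rfl) (hexp (-s) ω (neg_sq s)))
          rw [← sum_add_distrib]
          refine sum_le_sum fun e _ => ?_
          rw [← abs_of_pos hs, ← abs_mul, abs_of_pos hs, neg_mul]
          exact Real.exp_abs_le _
      _ = (Fintype.card (H → Bool) : ℝ) *
            (2 * (Fintype.card Ω : ℝ) * Real.exp (s ^ 2 * V / 2)) := by
          rw [sum_const, card_univ, nsmul_eq_mul]
          ring
      _ ≤ _ := by gcongr
  obtain ⟨e, -, he⟩ := exists_le_of_sum_le univ_nonempty htot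
  refine ⟨e, fun ω => ?_⟩
  have h1 := (single_le_sum (f := fun ω => Real.exp (s * |∑ h, sgn ℝ (e h) * c ω h|))
    (fun _ _ => (Real.exp_pos _).le) (mem_univ ω)).trans he
  have h2 := Real.log_le_log (Real.exp_pos _) h1
  rw [Real.log_exp, Real.log_mul hG0.ne' (Real.exp_pos _).ne', Real.log_exp] at h2
  have h3 : Real.log G / s + s * V / 2 = (Real.log G + s ^ 2 * V / 2) / s := by
    field_simp
  rw [h3, le_div_iff₀ hs, mul_comm]
  exact h2

/-! ### Rounding to a grid -/

/-- Rounding is towards zero, so moduli do not grow and the rounded vectors keep their ℓ_2 bounds.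
-/
theorem exists_int_round (y : ℝ) (K : ℕ) (hy : |y| ≤ K) :
    ∃ a ∈ Icc (-K : ℤ) K, |(a : ℝ)| ≤ |y| ∧ |y - a| ≤ 1 := by
  obtain ⟨hy1, hy2⟩ := abs_le.1 hy
  rcases le_total 0 y with h | h
  · have h1 := Int.floor_le y
    have h2 := Int.lt_floor_add_one y
    have h3 : 0 ≤ ⌊y⌋ := Int.floor_nonneg.2 h
    have h4 : ⌊y⌋ ≤ K := Int.cast_le (R := ℝ) |>.1 (by push_cast; linarith)
    refine ⟨⌊y⌋, mem_Icc.2 ⟨by omega, h4⟩, ?_, ?_⟩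
    · rw [abs_of_nonneg h, abs_of_nonneg (by exact_mod_cast h3)]
      exact h1
    · rw [abs_le]
      constructor <;> linarith
  · have h1 := Int.le_ceil y
    have h2 := Int.ceil_lt_add_one y
    have h3 : ⌈y⌉ ≤ 0 := Int.ceil_le.2 (by simpa using h)
    have h4 : -K ≤ ⌈y⌉ := Int.cast_le (R := ℝ) |>.1 (by push_cast; linarith)
    refine ⟨⌈y⌉, mem_Icc.2 ⟨h4, by omega⟩, ?_, ?_⟩
    · rw [abs_of_nonpos h, abs_of_nonpos (by exact_mod_cast h3)]
      linarith
    · rw [abs_le]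
      constructor <;> linarith

/-- The point `(a + b i) / K` of the grid with mesh `1 / K`. -/
noncomputable def gridPoint (𝕜 : Type*) [RCLike 𝕜] (K : ℕ) (q : ℤ × ℤ) : 𝕜 :=
  ((q.1 / K : ℝ) : 𝕜) + ((q.2 / K : ℝ) : 𝕜) * RCLike.I

section Rounding

variable {𝕜 : Type*} [RCLike 𝕜]

theorem norm_I_le_one : ‖(RCLike.I : 𝕜)‖ ≤ 1 := by
  by_cases h : (RCLike.I : 𝕜) = 0
  · simp [h]
  · exact (RCLike.norm_I_of_ne_zero h).le

theorem exists_gridPoint (x : 𝕜) (hx : ‖x‖ ≤ 1) (K : ℕ) (hK : 1 ≤ K) :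
    ∃ q ∈ Icc (-K : ℤ) K ×ˢ Icc (-K : ℤ) K,
      ‖gridPoint 𝕜 K q‖ ≤ ‖x‖ ∧ ‖x - gridPoint 𝕜 K q‖ ≤ 2 / K := by
  have hK0 : (0 : ℝ) < K := by exact_mod_cast hK
  have hmul (y : ℝ) (hy : |y| ≤ 1) : |y * K| ≤ K := by
    rw [abs_mul, abs_of_pos hK0]
    exact mul_le_of_le_one_left hK0.le hy
  have hdiv (y : ℝ) (a : ℤ) (h1 : |(a : ℝ)| ≤ |y * K|) (h2 : |y * K - a| ≤ 1) :
      |(a / K : ℝ)| ≤ |y| ∧ |y - a / K| ≤ 1 / K := by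
    constructor
    · rw [abs_div, abs_of_pos hK0, div_le_iff₀ hK0]
      rwa [abs_mul, abs_of_pos hK0] at h1
    · have : y - a / K = (y * K - a) / K := by field_simp
      rw [this, abs_div, abs_of_pos hK0]
      exact div_le_div_of_nonneg_right h2 hK0.le
  obtain ⟨a, ha, ha1, ha2⟩ := exists_int_round (RCLike.re x * K) K
    (hmul _ ((RCLike.abs_re_le_norm x).trans hx))
  obtain ⟨b, hb, hb1, hb2⟩ := exists_int_round (RCLike.im x * K) K
    (hmul _ ((RCLike.abs_im_le_norm x).trans hx))
  obtain ⟨ha3, ha4⟩ := hdiv _ _ ha1 ha2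
  obtain ⟨hb3, hb4⟩ := hdiv _ _ hb1 hb2
  refine ⟨(a, b), mem_product.2 ⟨ha, hb⟩, ?_, ?_⟩
  -- Over ℝ, `RCLike.I` is 0, so only an inequality is available for both fields.
  · have hIim : |RCLike.im (RCLike.I : 𝕜)| ≤ 1 := (RCLike.abs_im_le_norm _).trans norm_I_le_one
    have hre : RCLike.re (gridPoint 𝕜 K (a, b)) = a / K := by
      simp only [gridPoint, map_add, RCLike.re_ofReal_mul, RCLike.I_re, mul_zero, add_zero,
        RCLike.ofReal_re]
    have him : RCLike.im (gridPoint 𝕜 K (a, b)) = b / K * RCLike.im (RCLike.I : 𝕜) := by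
      simp only [gridPoint, map_add, RCLike.im_ofReal_mul, RCLike.ofReal_im, zero_add]
    have him' : |RCLike.im (gridPoint 𝕜 K (a, b))| ≤ |RCLike.im x| := by
      rw [him, abs_mul]
      exact (mul_le_of_le_one_right (abs_nonneg _) hIim).trans hb3
    rw [← hre] at ha3
    refine le_of_sq_le_sq ?_ (norm_nonneg x)
    rw [RCLike.norm_sq_eq_def, RCLike.norm_sq_eq_def]
    exact add_le_add (abs_le_iff_mul_self_le.1 ha3) (abs_le_iff_mul_self_le.1 him')
  · have : x - gridPoint 𝕜 K (a, b) = ((RCLike.re x - a / K : ℝ) : 𝕜) +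
        ((RCLike.im x - b / K : ℝ) : 𝕜) * RCLike.I := by
      conv_lhs => rw [← RCLike.re_add_im x]
      simp only [gridPoint, RCLike.ofReal_sub]
      ring
    rw [this]
    refine (norm_add_le _ _).trans ?_
    rw [norm_mul, RCLike.norm_ofReal, RCLike.norm_ofReal]
    have h5 : |RCLike.im x - b / K| * ‖(RCLike.I : 𝕜)‖ ≤ 1 / K :=
      (mul_le_of_le_one_right (abs_nonneg _) norm_I_le_one).trans hb4
    have h6 : (2 / K : ℝ) = 1 / K + 1 / K := by ring
    linarith

/-- Telescoping: replace one factor at a time. -/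
theorem norm_prod_sub_prod_le {κ : Type*} (s : Finset κ) (f g : κ → 𝕜) (hf : ∀ l, ‖f l‖ ≤ 1)
    (hg : ∀ l, ‖g l‖ ≤ 1) : ‖∏ l ∈ s, f l - ∏ l ∈ s, g l‖ ≤ ∑ l ∈ s, ‖f l - g l‖ := by
  classical
  induction s using Finset.induction_on with
  | empty => simp
  | insert a s ha ih =>
    rw [prod_insert ha, prod_insert ha, sum_insert ha]
    have h1 : f a * ∏ l ∈ s, f l - g a * ∏ l ∈ s, g l =
        (f a - g a) * ∏ l ∈ s, f l + g a * (∏ l ∈ s, f l - ∏ l ∈ s, g l) := by ring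
    rw [h1]
    refine (norm_add_le _ _).trans ?_
    rw [norm_mul, norm_mul, norm_prod]
    exact add_le_add
      (mul_le_of_le_one_right (norm_nonneg _) (prod_le_one (fun _ _ => norm_nonneg _) fun l _ => hf l))
      ((mul_le_of_le_one_left (norm_nonneg _) (hg a)).trans ih)

end Rounding

/-! ### Forms with random signs -/

theorem re_sgn_mul {𝕜 : Type*} [RCLike 𝕜] (b : Bool) (z : 𝕜) :
    RCLike.re (sgn 𝕜 b * z) = sgn ℝ b * RCLike.re z := by
  cases b <;> simp [sgn]

theorem im_sgn_mul {𝕜 : Type*} [RCLike 𝕜] (b : Bool) (z : 𝕜) :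
    RCLike.im (sgn 𝕜 b * z) = sgn ℝ b * RCLike.im z := by
  cases b <;> simp [sgn]

theorem norm_le_abs_re_add_abs_im {𝕜 : Type*} [RCLike 𝕜] (z : 𝕜) :
    ‖z‖ ≤ |RCLike.re z| + |RCLike.im z| := by
  conv_lhs => rw [← RCLike.re_add_im z]
  refine (norm_add_le _ _).trans ?_
  rw [norm_mul, RCLike.norm_ofReal, RCLike.norm_ofReal]
  exact add_le_add_right (mul_le_of_le_one_right (abs_nonneg _) norm_I_le_one) _

/-- The `ℓ_2`-norm on the unit ball of `ℓ_p`. -/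
theorem PiLp.sum_norm_sq_le {𝕜 : Type*} [NormedAddCommGroup 𝕜] {N : ℕ} (hN : 1 ≤ N) (p : ℝ≥0∞)
    [Fact (1 ≤ p)] (hp : (p⁻¹).toReal ≤ 1 / 2) (x : PiLp p (fun _ : Fin N => 𝕜)) (hx : ‖x‖ ≤ 1) :
    ∑ t, ‖x t‖ ^ 2 ≤ (N : ℝ) ^ (1 - 2 * (p⁻¹).toReal) := by
  have : NeZero N := ⟨by omega⟩
  obtain ⟨u, hu, hu1, hux⟩ := PiLp.exists_weight p x hx
  have h := sum_prod_rpow_le_card_rpow (fun _ : Unit => u) (fun _ => hu) (fun _ => hu1)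
    (fun _ => 2 * (p⁻¹).toReal) (fun _ => by positivity) (by simpa only [univ_unique, sum_singleton] using by linarith)
  simp only [univ_unique, prod_singleton, sum_singleton, Fintype.card_fin] at h
  refine (sum_le_sum fun t _ => ?_).trans h
  rw [mul_comm, Real.rpow_mul (hu t), Real.rpow_two]
  exact pow_le_pow_left₀ (norm_nonneg _) (hux t) 2

theorem log_grid_le (m N : ℕ) (hN : 1 ≤ N) :
    Real.log (4 * ((2 * (N : ℝ) ^ m + 1) ^ 2) ^ (m * N)) ≤
      (2 + 4 * m + 2 * m ^ 2) * ((1 + Real.log N) * N) := by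
  have hN1 : (1 : ℝ) ≤ N := by exact_mod_cast hN
  have hL : 0 ≤ Real.log N := Real.log_nonneg hN1
  have hpow : (1 : ℝ) ≤ (N : ℝ) ^ m := one_le_pow₀ hN1
  have h4 : Real.log 4 ≤ 2 := by
    rw [show (4 : ℝ) = 2 ^ 2 by norm_num, Real.log_pow]
    have := Real.log_two_lt_d9
    push_cast
    linarith
  have h3 : Real.log (2 * (N : ℝ) ^ m + 1) ≤ 2 + m * Real.log N := by
    calc Real.log (2 * (N : ℝ) ^ m + 1) ≤ Real.log (4 * (N : ℝ) ^ m) :=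
          Real.log_le_log (by positivity) (by linarith)
      _ = Real.log 4 + m * Real.log N := by
          rw [Real.log_mul (by norm_num) (by positivity), Real.log_pow]
      _ ≤ _ := by linarith
  rw [Real.log_mul (by norm_num) (by positivity), Real.log_pow, Real.log_pow]
  push_cast
  have hmN : (0 : ℝ) ≤ m * N := by positivity
  have h5 : (m * N : ℝ) * (2 * Real.log (2 * (N : ℝ) ^ m + 1)) ≤
      (m * N : ℝ) * (2 * (2 + m * Real.log N)) :=
    mul_le_mul_of_nonneg_left (by linarith) hmN
  have h6 : (0 : ℝ) ≤ N * Real.log N := by positivity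
  have h7 : (0 : ℝ) ≤ m * (N * Real.log N) := by positivity
  have h8 : (0 : ℝ) ≤ m * m * N := by positivity
  nlinarith

/-- A form with coefficients `±1` and small norm. -/
theorem exists_sign_form (𝕜 : Type*) [RCLike 𝕜] {m : ℕ} (p : Fin m → ℝ≥0∞)
    [∀ l, Fact (1 ≤ p l)] (hp : recipSum p ≤ 1 / 2) (N : ℕ) (hN : 1 ≤ N) :
    ∃ e : (Fin m → Fin N) → Bool, ‖tensorForm p fun h => sgn 𝕜 (e h)‖ ≤
      (5 + 10 * m + 4 * m ^ 2) *
        ((1 + Real.log N) * (N : ℝ) ^ (((m : ℝ) + 1) / 2 - recipSum p)) := by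
  classical
  have hN1 : (1 : ℝ) ≤ N := by exact_mod_cast hN
  have hN0 : (0 : ℝ) < N := by linarith
  have hL : 0 ≤ Real.log N := Real.log_nonneg hN1
  set σ := recipSum p with hσ
  set β := ((m : ℝ) + 1) / 2 - σ with hβ
  have hβ0 : 0 ≤ β := by
    have : (0 : ℝ) ≤ m := Nat.cast_nonneg m
    rw [hβ]
    linarith
  have hr (l : Fin m) : ((p l)⁻¹).toReal ≤ 1 / 2 :=
    (single_le_sum (f := fun l => ((p l)⁻¹).toReal) (fun _ _ => ENNReal.toReal_nonneg)
      (mem_univ l)).trans hp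
  -- Each of the N^m terms is moved by at most 2m/K in rounding, so this mesh keeps the total error
  -- at 2m.
  set K := N ^ m with hK
  have hK1 : 1 ≤ K := Nat.one_le_pow _ _ hN
  let A := {q : ℤ × ℤ // q ∈ Icc (-K : ℤ) K ×ˢ Icc (-K : ℤ) K}
  -- The union bound runs only over grid points with the ℓ_2 bounds inherited from the ℓ_p balls;
  -- these give the variance N^{m-2σ}.
  let Q := {q : Fin m → Fin N → A //
    ∀ l, ∑ t, ‖gridPoint 𝕜 K (q l t).1‖ ^ 2 ≤ (N : ℝ) ^ (1 - 2 * ((p l)⁻¹).toReal)}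
  let P : Q → (Fin m → Fin N) → 𝕜 := fun q h => ∏ l, gridPoint 𝕜 K (q.1 l (h l)).1
  have hPsq (q : Q) : ∑ h, ‖P q h‖ ^ 2 ≤ (N : ℝ) ^ ((m : ℝ) - 2 * σ) := by
    simp only [P, norm_prod, ← prod_pow]
    rw [← Fintype.prod_sum fun l t => ‖gridPoint 𝕜 K (q.1 l t).1‖ ^ 2]
    refine (prod_le_prod (fun _ _ => by positivity) fun l _ => q.2 l).trans_eq ?_
    rw [← Real.rpow_sum_of_pos hN0]
    congr 1
    simp [hσ, recipSum, mul_sum]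
  have hcardA : Fintype.card A = (2 * K + 1) ^ 2 := by
    simp only [A, Fintype.card_coe, card_product, Int.card_Icc]
    rw [sq]
    congr 1 <;> omega
  have hcardQ : Fintype.card Q ≤ ((2 * K + 1) ^ 2) ^ (m * N) := by
    refine (Fintype.card_subtype_le _).trans_eq ?_
    simp only [Fintype.card_fun, hcardA, Fintype.card_fin]
    rw [← pow_mul, mul_comm N m]
  -- As m - 2σ = 2β - 1, the choice s = N^{1-β} makes both terms of order N^β up to the logarithm.
  -- The factor 4 accounts for the two signs of the deviation and for real and imaginary parts.
  obtain ⟨e, he⟩ := exists_signs_abs_sum_le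
    (fun (q : Q × Bool) h => if q.2 then RCLike.re (P q.1 h) else RCLike.im (P q.1 h))
    ((N : ℝ) ^ ((m : ℝ) - 2 * σ)) ((N : ℝ) ^ (1 - β)) (4 * ((2 * (N : ℝ) ^ m + 1) ^ 2) ^ (m * N))
    (fun q => by
      refine (sum_le_sum fun h _ => ?_).trans (hPsq q.1)
      rw [← sq_abs]
      refine pow_le_pow_left₀ (abs_nonneg _) ?_ 2
      split_ifs
      · exact RCLike.abs_re_le_norm _
      · exact RCLike.abs_im_le_norm _)
    (by positivity)
    (by
      rw [Fintype.card_prod, Fintype.card_bool]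
      have : (Fintype.card Q : ℝ) ≤ (((2 * K + 1) ^ 2) ^ (m * N) : ℕ) := by exact_mod_cast hcardQ
      have hKN : (K : ℝ) = (N : ℝ) ^ m := by rw [hK, Nat.cast_pow]
      push_cast at this ⊢
      rw [hKN] at this
      linarith)
    (by positivity)
  have hbound : Real.log (4 * ((2 * (N : ℝ) ^ m + 1) ^ 2) ^ (m * N)) / (N : ℝ) ^ (1 - β) +
      (N : ℝ) ^ (1 - β) * (N : ℝ) ^ ((m : ℝ) - 2 * σ) / 2 ≤
      (5 / 2 + 4 * m + 2 * m ^ 2) * ((1 + Real.log N) * (N : ℝ) ^ β) := by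
    have h1 : (N : ℝ) ^ (1 - β) * (N : ℝ) ^ ((m : ℝ) - 2 * σ) = (N : ℝ) ^ β := by
      rw [← Real.rpow_add hN0]
      congr 1
      rw [hβ]
      ring
    have h2 : Real.log (4 * ((2 * (N : ℝ) ^ m + 1) ^ 2) ^ (m * N)) / (N : ℝ) ^ (1 - β) ≤
        (2 + 4 * m + 2 * m ^ 2) * ((1 + Real.log N) * (N : ℝ) ^ β) := by
      rw [div_le_iff₀ (by positivity)]
      refine (log_grid_le m N hN).trans_eq ?_
      have h3 : (N : ℝ) ^ β * (N : ℝ) ^ (1 - β) = N := by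
        rw [← Real.rpow_add hN0, add_sub_cancel, Real.rpow_one]
      rw [mul_assoc, mul_assoc, h3]
    rw [h1]
    have h4 : 0 ≤ (N : ℝ) ^ β := by positivity
    nlinarith [mul_nonneg hL h4]
  have hgrid (q : Q) : ‖∑ h, sgn 𝕜 (e h) * P q h‖ ≤
      2 * ((5 / 2 + 4 * m + 2 * m ^ 2) * ((1 + Real.log N) * (N : ℝ) ^ β)) := by
    have h1 := (he (q, true)).trans hbound
    have h2 := (he (q, false)).trans hbound
    simp only [if_true, Bool.false_eq_true, if_false] at h1 h2
    refine (norm_le_abs_re_add_abs_im _).trans ?_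
    simp only [map_sum, re_sgn_mul, im_sgn_mul]
    linarith
  refine ⟨e, opNorm_le_of_unit_ball _ _ (by positivity) fun x hx => ?_⟩
  have hx1 (l t) : ‖x l t‖ ≤ 1 := (PiLp.norm_apply_le (x l) t).trans (hx l)
  choose q hqmem hq1 hq2 using fun l t => exists_gridPoint (x l t) (hx1 l t) K hK1
  let q' : Q := ⟨fun l t => ⟨q l t, hqmem l t⟩, fun l =>
    (sum_le_sum fun t _ => pow_le_pow_left₀ (norm_nonneg _) (hq1 l t) 2).trans
      (PiLp.sum_norm_sq_le hN (p l) (hr l) (x l) (hx l))⟩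
  have hdiff : ‖∑ h, sgn 𝕜 (e h) * ∏ l, x l (h l) - ∑ h, sgn 𝕜 (e h) * P q' h‖ ≤ 2 * m := by
    rw [← sum_sub_distrib]
    refine (norm_sum_le _ _).trans ?_
    have h1 (h : Fin m → Fin N) :
        ‖sgn 𝕜 (e h) * ∏ l, x l (h l) - sgn 𝕜 (e h) * P q' h‖ ≤ m * (2 / K) := by
      rw [← mul_sub, norm_mul, norm_sgn, one_mul]
      refine (norm_prod_sub_prod_le univ (fun l => x l (h l))
        (fun l => gridPoint 𝕜 K (q l (h l))) (fun l => hx1 l _)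
        fun l => (hq1 l _).trans (hx1 l _)).trans ?_
      refine (sum_le_sum fun l _ => hq2 l (h l)).trans_eq ?_
      simp
    refine (sum_le_sum fun h _ => h1 h).trans_eq ?_
    rw [sum_const, card_univ, nsmul_eq_mul, Fintype.card_fun, Fintype.card_fin, Fintype.card_fin,
      ← hK]
    have : (K : ℝ) ≠ 0 := by positivity
    field_simp
  rw [tensorForm_apply]
  have htri := norm_le_norm_sub_add (∑ h, sgn 𝕜 (e h) * ∏ l, x l (h l))
    (∑ h, sgn 𝕜 (e h) * P q' h)
  have hone : (1 : ℝ) ≤ (1 + Real.log N) * (N : ℝ) ^ β :=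
    one_le_mul_of_one_le_of_one_le (by linarith) (Real.one_le_rpow hN1 hβ0)
  have hm : (2 * m : ℝ) ≤ 2 * m * ((1 + Real.log N) * (N : ℝ) ^ β) :=
    le_mul_of_one_le_right (by positivity) hone
  have := hgrid q'
  linarith

end PartialHardyLittlewood

theorem mainTheorem9 (𝕜 : Type*) [RCLike 𝕜] (k m : ℕ) (hk : 1 ≤ k) (hkm : k ≤ m)
    (p : Fin m → ℝ≥0∞) [∀ l, Fact (1 ≤ p l)]
    (hp : PartialHardyLittlewood.recipSum p ≤ 1 / 2)
    (n : Fin k → ℕ) (hn1 : ∀ j, 1 ≤ n j) (hn : ∑ j, n j = m) :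
    -- the set of admissible exponents is nonempty: it contains the claimed upper bound
    2 * (k : ℝ) / (k + 1 - 2 * PartialHardyLittlewood.recipSum p) ∈
        PartialHardyLittlewood.admissibleExponents 𝕜 p n hn ∧
    -- the lower bound, in its two cases
    ((k : ℝ) ≤ (m + 1 - 2 * PartialHardyLittlewood.recipSum p) /
          (2 - 2 * PartialHardyLittlewood.recipSum p) →
        (1 - PartialHardyLittlewood.recipSum p)⁻¹ ≤
          PartialHardyLittlewood.optimalExponent 𝕜 p n hn) ∧
    ((m + 1 - 2 * PartialHardyLittlewood.recipSum p) /
          (2 - 2 * PartialHardyLittlewood.recipSum p) ≤ (k : ℝ) →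
        2 * (k : ℝ) / (m + 1 - 2 * PartialHardyLittlewood.recipSum p) ≤
          PartialHardyLittlewood.optimalExponent 𝕜 p n hn) ∧
    -- the upper bound
    PartialHardyLittlewood.optimalExponent 𝕜 p n hn ≤
      2 * (k : ℝ) / (k + 1 - 2 * PartialHardyLittlewood.recipSum p) := by
  open PartialHardyLittlewood in
  have h0 := recipSum_nonneg p
  have hk1 : (1 : ℝ) ≤ k := by exact_mod_cast hk
  have hm1 : (1 : ℝ) ≤ m := hk1.trans (by exact_mod_cast hkm)
  -- The lower bounds need this as well: `sInf ∅ = 0` in ℝ.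
  have hmem : 2 * (k : ℝ) / (k + 1 - 2 * recipSum p) ∈ admissibleExponents 𝕜 p n hn := by
    refine ⟨div_pos (by linarith) (by linarith), ?_⟩
    obtain ⟨d, rfl⟩ : ∃ d, k = d + 1 := ⟨k - 1, by omega⟩
    exact ⟨_, inequality_of_recipSum_le p hp n hn1 hn⟩
  refine ⟨hmem, fun _ => ?_, fun _ => ?_, csInf_le ⟨0, fun ρ hρ => hρ.1.le⟩ hmem⟩
  · refine le_csInf ⟨_, hmem⟩ ?_
    rintro ρ ⟨hρ, C, hC⟩
    have := div_le_of_inequality hρ hC 1 1 (1 - recipSum p) fun N hN => by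
      obtain ⟨T, hT, hs⟩ := exists_diagonal_form (𝕜 := 𝕜) hk p (by linarith) n hn1 hn ρ N hN
      refine ⟨T, hT.trans ?_, by simpa using hs⟩
      rw [one_mul]
      refine le_mul_of_one_le_left (by positivity) ?_
      have := Real.log_natCast_nonneg N
      linarith
    rw [inv_le_comm₀ (by linarith) hρ, inv_eq_one_div]
    exact this
  · refine le_csInf ⟨_, hmem⟩ ?_
    rintro ρ ⟨hρ, C, hC⟩
    have := div_le_of_inequality hρ hC (5 + 10 * m + 4 * m ^ 2) k (((m : ℝ) + 1) / 2 - recipSum p)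
      fun N hN => by
        obtain ⟨e, he⟩ := exists_sign_form 𝕜 p hp N hN
        refine ⟨_, he, le_of_eq ?_⟩
        simp [tensorForm_repeatedBasis]
    rw [div_le_iff₀ hρ] at this
    rw [div_le_iff₀ (by linarith)]
    linarith
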